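/- Let $E$ be a finite set, let $r\ge 0$ be an integer, and let $\mathbb{Z}[E]:=\mathbb{Z}[t_e\mid e\in E]$. For a matroid $M$ with ground set $E$, with rank function $\operatorname{rk}_M$, rank $\operatorname{rk}(M)=\operatorname{rk}_M(E)$ and nullity $\operatorname{null}_M(S)=|S|-\operatorname{rk}_M(S)$, let $$\widehat{T}_M(x,y,u,v)=\sum_{S\subseteq E}(x-1)^{\operatorname{rk}(M)-\operatorname{rk}_M(S)}(y-1)^{\operatorname{null}_M(S)}\prod_{e\in S}(1+u\,t_e)\prod_{e\in E\setminus S}(1+v\,t_e)\in\mathbb{Z}[E][x,y,u,v]$$ be its equivariant Tutte polynomial, and let $$\widehat{\chi}_M(q)=\frac{(-1)^{\operatorname{rk}(M)}}{q-1}\,\widehat{T}_M(1-q,0,q,1)\in\operatorname{Frac}(\mathbb{Z}[E][q])$$ be its equivariant reduced characteristic polynomial. Let $\mathrm{Mat}_r(E)$ be the free abelian group generated by the matroids of rank $r$ with ground set $E$. For such a matroid $M$ let $P(M)\subset\mathbb{R}^E$ be its base polytope, the convex hull of the vectors $\sum_{b\in B}e_b$ with $B$ a basis of $M$, and let $\mathbf{1}_{P(M)}$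 be its indicator function. A group homomorphism $f:\mathrm{Mat}_r(E)\to G$ to an abelian group $G$ is called valuative if $f(\sum_M z_M M)=0$ for all integers $z_M$ such that $\sum_M z_M\mathbf{1}_{P(M)}$ is identically zero on $\mathbb{R}^E$. Then the group homomorphism $\mathrm{Mat}_r(E)\to\operatorname{Frac}(\mathbb{Z}[E][q])$ that extends $M\mapsto\widehat{\chi}_M$ is valuative. Moreover, if $E\neq\emptyset$, then $\widehat{\chi}_M\in\mathbb{Z}[E][q]$ for every matroid $M$ of rank $r$ with ground set $E$, and $M\mapsto\widehat{\chi}_M$ extends to a valuative group homomorphism $\mathrm{Mat}_r(E)\to\mathbb{Z}[E][q]$. -/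

import Mathlib

namespace EquivariantMatroid

variable {E : Type*}

/-- The rank `rk_M(S)` of a set `S` in a matroid on a finite ground set, as a natural number. -/
noncomputable def rk (M : Matroid E) (S : Set E) : ℕ := (M.eRk S).toNat

/-- The rank `rk(M)` of a matroid on a finite ground set, as a natural number. -/
noncomputable def rank (M : Matroid E) : ℕ := rk M M.E

/-- The nullity `|S| - rk_M(S)`; the subtraction does not truncate, as `rk_M(S) ≤ |S|`. -/
noncomputable def nullity (M : Matroid E) (S : Finset E) : ℕ := S.card - rk M S

/-- The matroids of rank `r` whose ground set is all of `E`. -/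
def MatroidsOfRank (E : Type*) (r : ℕ) : Type _ :=
  {M : Matroid E // M.E = Set.univ ∧ M.eRank = r}

/-- `Mat_r(E)`: the free abelian group on the matroids of rank `r` on `E`, whose elements are the
finite formal sums `∑ z_M M` with integers `z_M`. -/
abbrev Mat (r : ℕ) (E : Type*) : Type _ := MatroidsOfRank E r →₀ ℤ

/-- The base polytope `P(M) ⊆ ℝ^E`: the convex hull of the 0/1-vectors `∑_{b ∈ B} e_b` of the
bases `B` of `M`. -/
def basePolytope (M : Matroid E) : Set (E → ℝ) :=
  convexHull ℝ {v | ∃ B : Set E, M.IsBase B ∧ v = B.indicator 1}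

/-- A group morphism on `Mat_r(E)` is valuative if it kills every formal sum `∑ z_M M` for which
the function `∑ z_M 1_{P(M)}` vanishes identically on `ℝ^E`. -/
def IsValuative {r : ℕ} {G : Type*} [AddCommGroup G] (f : Mat r E →+ G) : Prop :=
  ∀ z : Mat r E,
    (∀ x : E → ℝ, (z.sum fun M c => c * (basePolytope M.1).indicator (fun _ => (1 : ℤ)) x) = 0) →
      f z = 0

/-- The group morphism on `Mat_r(E)` that extends an assignment `M ↦ φ(M)`. -/
noncomputable def linearExtension {r : ℕ} {G : Type*} [AddCommGroup G]
    (φ : Matroid E → G) : Mat r E →+ G :=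
  (Finsupp.linearCombination ℤ fun M : MatroidsOfRank E r => φ M.1).toAddMonoidHom

/-- `ℤ[E]`: the polynomial ring over `ℤ` with one variable `t_e` for each `e ∈ E`. -/
abbrev ZE (E : Type*) : Type _ := MvPolynomial E ℤ

/-- The equivariant Tutte polynomial in `ℤ[E][x, y, r, s]`; the variables `x, y, r, s` are
`X 0, X 1, X 2, X 3`, and the variable `t_e` is the constant `C (X e)`. -/
noncomputable def equivariantTutte [Fintype E] [DecidableEq E] (M : Matroid E) :
    MvPolynomial (Fin 4) (ZE E) :=
  ∑ S : Finset E,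
    (MvPolynomial.X 0 - 1) ^ (rank M - rk M S) * (MvPolynomial.X 1 - 1) ^ nullity M S *
      (∏ e ∈ S, (1 + MvPolynomial.X 2 * MvPolynomial.C (MvPolynomial.X e))) *
      ∏ e ∈ Sᶜ, (1 + MvPolynomial.X 3 * MvPolynomial.C (MvPolynomial.X e))

/-- The specialization of the equivariant Tutte polynomial at `(x, y, r, s) = (1 - q, 0, q, 1)`,
a polynomial in `ℤ[E][q]`. -/
noncomputable def specializedTutte [Fintype E] [DecidableEq E] (M : Matroid E) :
    Polynomial (ZE E) :=
  MvPolynomial.aeval ![1 - Polynomial.X, 0, Polynomial.X, 1] (equivariantTutte M)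

/-- The equivariant reduced characteristic polynomial
`(-1)^{rk(M)} / (q - 1) * T_M(1 - q, 0, q, 1)`, as an element of the fraction field
of `ℤ[E][q]`. -/
noncomputable def equivariantReducedChar [Fintype E] [DecidableEq E] (M : Matroid E) :
    FractionRing (Polynomial (ZE E)) :=
  (-1) ^ rank M / (algebraMap (Polynomial (ZE E)) _ (Polynomial.X - 1)) *
    algebraMap (Polynomial (ZE E)) _ (specializedTutte M)

end EquivariantMatroid

/-! In the subset expansion of `specializedTutte`, the rank being fixed at `r`, the summand of `S`
depends on `M` only through `rk M S`. So it suffices that every function of `rk M S` is valuative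
(`sum_smul_rk`). Now `rk M S` is the maximum of a linear functional on the base polytope, so `k ≤ rk
M S` says that the polytope meets a half-space (`le_rk_iff`). Cutting by a half-space preserves
linear relations between indicators, and such relations between compact convex sets persist when
each indicator is replaced by 1 or 0 according to nonemptiness
(`sum_ite_nonempty_eq_zero_of_convex`).

Integrality holds because the specialization vanishes at `q = 1` when `E` is nonempty. -/

open Filter Topology in
/-- Just to the right of `t`, membership in a compact interval changes exactly when `t` is its
greatest element. -/
theorem eventually_mem_iff_of_isCompact_ordConnected {K : Set ℝ} (hc : IsCompact K)
    (ho : K.OrdConnected) (t : ℝ) :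
    ∀ᶠ s in 𝓝[>] t, (s ∈ K ↔ t ∈ K ∧ ¬ IsGreatest K t) := by
  by_cases ht : t ∈ K
  · by_cases hg : IsGreatest K t
    · filter_upwards [self_mem_nhdsWithin] with s hs
      exact ⟨fun h => absurd (hg.2 h) (not_le.2 hs), fun h => absurd hg h.2⟩
    · obtain ⟨u, hu, htu⟩ : ∃ u ∈ K, t < u := by
        by_contra! h
        exact hg ⟨ht, h⟩
      filter_upwards [Ioo_mem_nhdsGT htu] with s hs
      exact ⟨fun _ => ⟨ht, hg⟩, fun _ => ho.out ht hu ⟨hs.1.le, hs.2.le⟩⟩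
  · filter_upwards [mem_nhdsWithin_of_mem_nhds (hc.isClosed.isOpen_compl.mem_nhds ht)] with s hs
    exact ⟨fun h => absurd h hs, fun h => absurd h.1 ht⟩

open scoped Classical in
open Filter Topology in
/-- The Euler characteristic of compact intervals is well defined on their indicator functions. -/
theorem sum_ite_nonempty_eq_zero_of_ordConnected {ι : Type*} (s : Finset ι) (z : ι → ℤ)
    (K : ι → Set ℝ) (hc : ∀ i, IsCompact (K i)) (ho : ∀ i, (K i).OrdConnected)
    (h : ∀ x, ∑ i ∈ s, (if x ∈ K i then z i else 0) = 0) :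
    ∑ i ∈ s, (if (K i).Nonempty then z i else 0) = 0 := by
  have key (t : ℝ) : ∑ i ∈ s, (if IsGreatest (K i) t then z i else 0) = 0 := by
    have hev : ∀ᶠ u in 𝓝[>] t, ∀ i ∈ s, (u ∈ K i ↔ t ∈ K i ∧ ¬ IsGreatest (K i) t) :=
      (Finset.eventually_all s).2 fun i _ =>
        eventually_mem_iff_of_isCompact_ordConnected (hc i) (ho i) t
    -- Subtracting the relation at `u` from the one at `t` leaves exactly the intervals with maximum
    -- `t`.
    obtain ⟨u, hu⟩ := hev.exists
    have hsub := (Finset.sum_sub_distrib (s := s) (fun i => if t ∈ K i then z i else 0)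
      fun i => if u ∈ K i then z i else 0).trans (by rw [h, h, sub_zero])
    refine (Finset.sum_congr rfl fun i hi => ?_).trans hsub
    have := hu i hi
    by_cases ht : t ∈ K i
    · by_cases hg : IsGreatest (K i) t <;> simp [this, ht, hg]
    · have hg : ¬ IsGreatest (K i) t := fun hg => ht hg.1
      simp [this, ht, hg]
  -- Each nonempty interval has exactly one maximum, so it is counted once.
  rw [← Finset.sum_filter, ← Finset.sum_fiberwise_of_maps_to
    (t := s.image fun i => sSup (K i)) (g := fun i => sSup (K i))
    fun i hi => Finset.mem_image_of_mem _ (Finset.mem_filter.1 hi).1]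
  refine Finset.sum_eq_zero fun t _ => ?_
  rw [← key t, ← Finset.sum_filter, Finset.filter_filter]
  refine Finset.sum_congr (Finset.filter_congr fun i _ => ⟨?_, fun hg => ⟨⟨t, hg.1⟩, hg.csSup_eq⟩⟩)
    fun _ _ => rfl
  rintro ⟨hn, rfl⟩
  exact (hc i).isGreatest_sSup hn

open scoped Classical in
/-- The Euler characteristic of compact convex sets is well defined on their indicator
functions. -/
theorem sum_ite_nonempty_eq_zero_of_convex {E ι : Type*} [Finite E] (s : Finset ι) (z : ι → ℤ)
    (K : ι → Set (E → ℝ)) (hc : ∀ i, IsCompact (K i)) (hK : ∀ i, Convex ℝ (K i))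
    (h : ∀ x, ∑ i ∈ s, (if x ∈ K i then z i else 0) = 0) :
    ∑ i ∈ s, (if (K i).Nonempty then z i else 0) = 0 := by
  have := Fintype.ofFinite E
  -- Project away the coordinates in `A`: the relation survives each projection, and after all of
  -- them only nonemptiness is left.
  have key (A : Finset E) : ∀ x : E → ℝ,
      ∑ i ∈ s, (if ∃ y ∈ K i, ∀ e ∉ A, y e = x e then z i else 0) = 0 := by
    induction A using Finset.induction_on with
    | empty =>
      intro x
      refine (Finset.sum_congr rfl fun i _ => ?_).trans (h x)
      congr 1
      refine propext ⟨?_, fun hx => ⟨x, hx, fun _ _ => rfl⟩⟩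
      rintro ⟨y, hy, hyx⟩
      rwa [show x = y from funext fun e => (hyx e (Finset.notMem_empty e)).symm]
    | insert a A ha ih =>
      intro x
      let F : Set (E → ℝ) := {y | ∀ e ∉ insert a A, y e = x e}
      have hF : IsClosed F := by
        simp only [F, Set.ofPred_forall]
        exact isClosed_iInter fun e => isClosed_iInter fun _ =>
          isClosed_eq (continuous_apply e) continuous_const
      have hF' : Convex ℝ F := by
        intro y hy w hw α β _ _ hαβ e he
        simp only [Pi.add_apply, Pi.smul_apply, smul_eq_mul, hy e he, hw e he]
        rw [← add_mul, hαβ, one_mul]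
      -- Over a fixed `x`, the possible values of coordinate `a` form a compact interval, so the
      -- one-dimensional case eliminates `a`.
      have hmain := sum_ite_nonempty_eq_zero_of_ordConnected s z
        (fun i => (fun y : E → ℝ => y a) '' (K i ∩ F))
        (fun i => ((hc i).inter_right hF).image (continuous_apply a))
        (fun i => (((hK i).inter hF').linear_image (LinearMap.proj a)).ordConnected) ?_
      · refine (Finset.sum_congr rfl fun i _ => ?_).trans hmain
        simp only [Set.image_nonempty]
        rfl
      · intro t
        refine (Finset.sum_congr rfl fun i _ => ?_).trans (ih (Function.update x a t))
        congr 1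
        refine propext ⟨?_, ?_⟩
        · rintro ⟨y, ⟨hy, hyF⟩, rfl⟩
          refine ⟨y, hy, fun e he => ?_⟩
          by_cases hea : e = a
          · subst hea; simp
          · rw [Function.update_of_ne hea]
            exact hyF e (by simp [hea, he])
        · rintro ⟨y, hy, hyx⟩
          refine ⟨y, ⟨hy, fun e he => ?_⟩, by simpa using hyx a ha⟩
          rw [Finset.mem_insert, not_or] at he
          rw [hyx e he.2, Function.update_of_ne he.1]
  refine (Finset.sum_congr rfl fun i _ => ?_).trans (key Finset.univ 0)
  exact if_congr (by simp [Set.Nonempty]) rfl rfl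

namespace EquivariantMatroid

theorem isCompact_basePolytope {E : Type*} [Finite E] (M : Matroid E) :
    IsCompact (basePolytope M) := by
  refine Set.Finite.isCompact_convexHull ℝ
    (((Set.toFinite {B : Set E | M.IsBase B}).image fun B => B.indicator 1).subset ?_)
  rintro v ⟨B, hB, rfl⟩
  exact ⟨B, hB, rfl⟩

theorem coe_rk {E : Type*} [Finite E] (M : Matroid E) (S : Set E) : (rk M S : ℕ∞) = M.eRk S :=
  ENat.natCast_toNat (ne_top_of_le_ne_top (Set.encard_ne_top_iff.2 S.toFinite) (M.eRk_le_encard S))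

theorem rk_le_card {E : Type*} [Finite E] (M : Matroid E) (S : Finset E) : rk M S ≤ S.card := by
  have := M.eRk_le_encard S
  rwa [← coe_rk, Set.encard_coe_eq_coe_finsetCard, Nat.cast_le] at this

theorem rk_le_rank {E : Type*} [Finite E] (M : Matroid E) (S : Set E) : rk M S ≤ rank M := by
  have := M.eRk_le_eRank S
  rwa [← M.eRk_ground, ← coe_rk, ← coe_rk, Nat.cast_le] at this

theorem MatroidsOfRank.rank_eq {E : Type*} {r : ℕ} (M : MatroidsOfRank E r) : rank M.1 = r := by
  rw [rank, rk, Matroid.eRk_ground, M.2.2, ENat.toNat_natCast]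

theorem sum_indicator_one {E : Type*} [DecidableEq E] (S : Finset E) (B : Set E) :
    ∑ e ∈ S, B.indicator (1 : E → ℝ) e = ((B ∩ S).ncard : ℝ) := by
  classical
  simp only [Set.indicator_apply, Pi.one_apply, Finset.sum_boole]
  rw [← Set.ncard_coe_finset]
  congr 2
  ext e
  simp [and_comm]

/-- The rank of `S` is the maximum of `x ↦ ∑ e ∈ S, x e` on the base polytope. -/
theorem le_rk_iff {E : Type*} [Finite E] [DecidableEq E] (M : Matroid E) (hM : M.E = Set.univ)
    (S : Finset E) (k : ℕ) :
    k ≤ rk M S ↔ (basePolytope M ∩ {x | (k : ℝ) ≤ ∑ e ∈ S, x e}).Nonempty := by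
  constructor
  · intro hk
    -- A base extending a basis of `S` gives a vertex attaining the maximum.
    obtain ⟨I, hI⟩ := M.exists_isBasis (S : Set E) (by simp [hM])
    obtain ⟨B, hB, hIB⟩ := hI.exists_isBase
    refine ⟨B.indicator 1, subset_convexHull ℝ _ ⟨B, hB, rfl⟩, ?_⟩
    rw [Set.mem_ofPred_eq, sum_indicator_one, Nat.cast_le, ← hIB]
    have := hI.encard_eq_eRk
    rw [← coe_rk, ← I.toFinite.cast_ncard_eq, Nat.cast_inj] at this
    omega
  · rintro ⟨x, hx, hk⟩
    have hconv : Convex ℝ {x : E → ℝ | ∑ e ∈ S, x e ≤ rk M S} := by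
      have := convex_halfSpace_le (𝕜 := ℝ)
        (f := fun x : E → ℝ => ∑ e ∈ S, x e)
        ⟨fun x y => by simp [Finset.sum_add_distrib], fun c x => by simp [Finset.mul_sum]⟩
        (rk M S : ℝ)
      exact this
    have hsub : basePolytope M ⊆ {x : E → ℝ | ∑ e ∈ S, x e ≤ rk M S} := by
      refine convexHull_min ?_ hconv
      rintro v ⟨B, hB, rfl⟩
      rw [Set.mem_ofPred_eq, sum_indicator_one, Nat.cast_le]
      have := (hB.indep.inter_right (S : Set E)).encard_le_eRk_of_subset Set.inter_subset_right
      rwa [← coe_rk, ← (Set.toFinite _).cast_ncard_eq, Nat.cast_le] at this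
    exact_mod_cast hk.out.trans (hsub hx)

open scoped Classical in
/-- The indicator of the matroids in which `S` has rank at least `k` is valuative. -/
theorem sum_ite_le_rk {E : Type*} [Finite E] {r : ℕ} (z : Mat r E)
    (hz : ∀ x : E → ℝ,
      (z.sum fun M c => c * (basePolytope M.1).indicator (fun _ => (1 : ℤ)) x) = 0)
    (S : Finset E) (k : ℕ) :
    ∑ M ∈ z.support, (if k ≤ rk M.1 S then z M else 0) = 0 := by
  have hH : IsClosed {x : E → ℝ | (k : ℝ) ≤ ∑ e ∈ S, x e} :=
    isClosed_le continuous_const (by fun_prop)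
  have hH' : Convex ℝ {x : E → ℝ | (k : ℝ) ≤ ∑ e ∈ S, x e} := by
    have := convex_halfSpace_ge (𝕜 := ℝ)
      (f := fun x : E → ℝ => ∑ e ∈ S, x e)
      ⟨fun x y => by simp [Finset.sum_add_distrib], fun c x => by simp [Finset.mul_sum]⟩
      (k : ℝ)
    exact this
  refine (Finset.sum_congr rfl fun M _ => ?_).trans
    (sum_ite_nonempty_eq_zero_of_convex z.support z
      (fun M => basePolytope M.1 ∩ {x | (k : ℝ) ≤ ∑ e ∈ S, x e})
      (fun M => (isCompact_basePolytope M.1).inter_right hH)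
      (fun M => (convex_convexHull ℝ _).inter hH') fun x => ?_)
  · simp only [le_rk_iff M.1 M.2.1]
  by_cases hx : (k : ℝ) ≤ ∑ e ∈ S, x e
  · refine (Finset.sum_congr rfl fun M _ => ?_).trans (hz x)
    simp [Set.indicator_apply, hx]
  · exact Finset.sum_eq_zero fun M _ => if_neg fun h => hx h.2

/-- Every function of the rank of a fixed set `S` is valuative. -/
theorem sum_smul_rk {E : Type*} [Finite E] {r : ℕ} {G : Type*} [AddCommGroup G] (z : Mat r E)
    (hz : ∀ x : E → ℝ,
      (z.sum fun M c => c * (basePolytope M.1).indicator (fun _ => (1 : ℤ)) x) = 0)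
    (S : Finset E) (g : ℕ → G) :
    ∑ M ∈ z.support, z M • g (rk M.1 S) = 0 := by
  classical
  rw [← Finset.sum_fiberwise_of_maps_to (t := z.support.image fun M => rk M.1 S)
    (g := fun M => rk M.1 S) fun M hM => Finset.mem_image_of_mem _ hM]
  refine Finset.sum_eq_zero fun k _ => ?_
  -- Rank exactly `k` is the threshold `k` minus the threshold `k + 1`.
  have hk : ∑ M ∈ z.support with rk M.1 S = k, z M = 0 := by
    have hsub := (Finset.sum_sub_distrib (s := z.support)
      (fun M => if k ≤ rk M.1 S then z M else 0)
      fun M => if k + 1 ≤ rk M.1 S then z M else 0).trans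
      (by rw [sum_ite_le_rk z hz, sum_ite_le_rk z hz, sub_zero])
    rw [Finset.sum_filter]
    refine (Finset.sum_congr rfl fun M _ => ?_).trans hsub
    split_ifs <;> omega
  rw [← zero_smul ℤ (g k), ← hk, Finset.sum_smul]
  exact Finset.sum_congr rfl fun M hM => by rw [(Finset.mem_filter.1 hM).2]

variable {E : Type*} [Fintype E] [DecidableEq E]

theorem specializedTutte_eq (M : Matroid E) :
    specializedTutte M = ∑ S : Finset E,
      (1 - Polynomial.X - 1) ^ (rank M - rk M S) * (0 - 1) ^ (S.card - rk M S) *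
        (∏ e ∈ S, (1 + Polynomial.X * Polynomial.C (MvPolynomial.X e))) *
        ∏ e ∈ Sᶜ, (1 + 1 * Polynomial.C (MvPolynomial.X e)) := by
  simp [specializedTutte, equivariantTutte, nullity, map_sum, map_prod,
    Polynomial.algebraMap_eq]

/-- At `q = 1` both products have the same factors, and the two sign exponents sum to `rank M +
S.card` modulo 2. What remains is a constant times the alternating sum over all subsets of a
nonempty set, which is zero. -/
theorem X_sub_one_dvd_specializedTutte [Nonempty E] (M : Matroid E) :
    Polynomial.X - 1 ∣ specializedTutte M := by
  rw [← Polynomial.C_1, Polynomial.dvd_iff_isRoot, Polynomial.IsRoot.def, specializedTutte_eq,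
    Polynomial.eval_finsetSum]
  have hterm (S : Finset E) :
      Polynomial.eval (1 : ZE E) ((1 - Polynomial.X - 1) ^ (rank M - rk M S) *
        (0 - 1) ^ (S.card - rk M S) *
        (∏ e ∈ S, (1 + Polynomial.X * Polynomial.C (MvPolynomial.X e))) *
        ∏ e ∈ Sᶜ, (1 + 1 * Polynomial.C (MvPolynomial.X e))) =
      (-1) ^ S.card * ((-1) ^ rank M * ∏ e, (1 + MvPolynomial.X e)) := by
    have hpow : (-1 : ZE E) ^ (rank M - rk M S) * (-1) ^ (S.card - rk M S) =
        (-1) ^ S.card * (-1) ^ rank M := by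
      obtain ⟨a, ha⟩ := Nat.exists_eq_add_of_le (rk_le_rank M S)
      obtain ⟨b, hb⟩ := Nat.exists_eq_add_of_le (rk_le_card M S)
      rw [ha, hb, Nat.add_sub_cancel_left, Nat.add_sub_cancel_left, ← pow_add, ← pow_add,
        show rk M S + b + (rk M S + a) = 2 * rk M S + (a + b) by ring, pow_add _ (2 * _),
        pow_mul, neg_one_sq, one_pow, one_mul]
    simp only [Polynomial.eval_mul, Polynomial.eval_pow, Polynomial.eval_prod,
      Polynomial.eval_sub, Polynomial.eval_add, Polynomial.eval_one, Polynomial.eval_X,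
      Polynomial.eval_C, Polynomial.eval_neg, sub_self, zero_sub, one_mul]
    rw [hpow, mul_assoc _ (∏ e ∈ S, _), Finset.prod_mul_prod_compl, mul_assoc]
  have hsum : ∑ S : Finset E, (-1 : ZE E) ^ S.card = 0 := by
    have := congrArg (Int.cast : ℤ → ZE E)
      (Finset.sum_powerset_neg_one_pow_card_of_nonempty (Finset.univ_nonempty (α := E)))
    simpa using this
  simp only [hterm]
  rw [← Finset.sum_mul, hsum, zero_mul]

theorem isValuative_equivariantReducedChar (r : ℕ) :
    IsValuative (linearExtension equivariantReducedChar :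
      Mat r E →+ FractionRing (Polynomial (ZE E))) := by
  intro z hz
  have hT : ∑ M ∈ z.support, z M • specializedTutte M.1 = 0 := by
    simp only [specializedTutte_eq, MatroidsOfRank.rank_eq, Finset.smul_sum]
    rw [Finset.sum_comm]
    exact Finset.sum_eq_zero fun S _ => sum_smul_rk z hz S fun k =>
      (1 - Polynomial.X - 1) ^ (r - k) * (0 - 1) ^ (S.card - k) *
        (∏ e ∈ S, (1 + Polynomial.X * Polynomial.C (MvPolynomial.X e))) *
        ∏ e ∈ Sᶜ, (1 + 1 * Polynomial.C (MvPolynomial.X e))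
  have hχ : linearExtension equivariantReducedChar z =
      (-1) ^ r / (algebraMap (Polynomial (ZE E)) (FractionRing (Polynomial (ZE E)))
        (Polynomial.X - 1)) *
      algebraMap (Polynomial (ZE E)) _ (∑ M ∈ z.support, z M • specializedTutte M.1) := by
    rw [map_sum, Finset.mul_sum]
    refine Finset.sum_congr rfl fun M _ => ?_
    simp only [equivariantReducedChar, MatroidsOfRank.rank_eq, map_zsmul, mul_smul_comm]
    rfl
  rw [hχ, hT, map_zero, mul_zero]

theorem exists_algebraMap_eq_equivariantReducedChar [Nonempty E] (M : Matroid E) :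
    ∃ p : Polynomial (ZE E),
      algebraMap _ (FractionRing (Polynomial (ZE E))) p = equivariantReducedChar M := by
  obtain ⟨p, hp⟩ := X_sub_one_dvd_specializedTutte M
  refine ⟨(-1) ^ rank M * p, ?_⟩
  have hne : algebraMap (Polynomial (ZE E)) (FractionRing (Polynomial (ZE E)))
      (Polynomial.X - 1) ≠ 0 := by
    rw [Ne, FaithfulSMul.algebraMap_eq_zero_iff, ← Polynomial.C_1]
    exact Polynomial.X_sub_C_ne_zero 1
  rw [equivariantReducedChar, hp, map_mul, map_mul, map_pow, map_neg, map_one]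
  field_simp

end EquivariantMatroid

theorem mainTheorem12 {E : Type*} [Fintype E] [DecidableEq E] (r : ℕ) :
    EquivariantMatroid.IsValuative
      (EquivariantMatroid.linearExtension EquivariantMatroid.equivariantReducedChar :
        EquivariantMatroid.Mat r E →+
          FractionRing (Polynomial (EquivariantMatroid.ZE E))) ∧
    (Nonempty E →
      ∃ f : EquivariantMatroid.Mat r E →+ Polynomial (EquivariantMatroid.ZE E),
        EquivariantMatroid.IsValuative f ∧
        ∀ M : EquivariantMatroid.MatroidsOfRank E r,
          algebraMap (Polynomial (EquivariantMatroid.ZE E))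
              (FractionRing (Polynomial (EquivariantMatroid.ZE E))) (f (Finsupp.single M 1)) =
            EquivariantMatroid.equivariantReducedChar M.1) := by
  refine ⟨EquivariantMatroid.isValuative_equivariantReducedChar r, fun _ => ?_⟩
  choose p hp using
    EquivariantMatroid.exists_algebraMap_eq_equivariantReducedChar (E := E)
  have hf (z : EquivariantMatroid.Mat r E) :
      algebraMap _ (FractionRing (Polynomial (EquivariantMatroid.ZE E)))
        (EquivariantMatroid.linearExtension p z) =
      EquivariantMatroid.linearExtension EquivariantMatroid.equivariantReducedChar z := by
    simp [EquivariantMatroid.linearExtension, Finsupp.linearCombination_apply, Finsupp.sum, hp]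
  refine ⟨EquivariantMatroid.linearExtension p, fun z hz => ?_, fun M => ?_⟩
  -- Valuativity descends from the fraction field because the polynomial ring embeds in it.
  · apply FaithfulSMul.algebraMap_injective (Polynomial (EquivariantMatroid.ZE E))
      (FractionRing (Polynomial (EquivariantMatroid.ZE E)))
    rw [hf, EquivariantMatroid.isValuative_equivariantReducedChar r z hz, map_zero]
  · rw [hf]
    simp [EquivariantMatroid.linearExtension]
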